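/- Let $\Gamma$ be a simplicial graph with finite vertex set $V$, and let $W_\Gamma=\langle V \mid s^2=1\ (s\in V),\ st=ts\ (s,t \text{ adjacent in } \Gamma)\rangle$ be the associated right-angled Coxeter group. A word in $V$ is reduced if no shorter word represents the same element of $W_\Gamma$. A $\Gamma$-labeled cube complex is a cube complex whose edges are labeled by vertices of $\Gamma$ so that edges of a cube dual to a common midcube have the same label, and the edges of a cube at any one of its corners have distinct, pairwise adjacent labels. Edges joining a vertex to itself and multiple edges are allowed. The label of an edge path is the word read along it; a loop is a closed edge path, possibly of length zero or with backtracking. Such a complex is folded if no two distinct edges with a common endpoint have the same label and no two distinct cubes of the same dimension $\ge 2$ have equal boundaries. It is cube-full if any $n$ edges at a common vertex whose labels form an $n$-clique of $\Gamma$ are contained in a common $n$-cube. Let $G$ be a subgroup of $W_\Gamma$. A completion $(\Omega,B)$ of $G$ is a connected, folded and cube-full $\Gamma$-labeled cube complex $\Omega$ with a base vertex $B$, such that the label of every loop based at $B$ represents an element of $G$, and every reduced word that represents an element of $G$ is the label of some loop based at $B$. For a vertex $v$ of $\Omega$, the core graph $C(\Omega,v)$ is the subgraph of the 1-skeleton of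 $\Omega$ that is the union of all loops based at $v$ whose labels are reduced words. Theorem. Let $G$ be a subgroup of $W_\Gamma$ with completion $(\Omega,B)$, and let $\Delta=\{s\in V \mid s \text{ commutes with every element of } G\}$. Then $G$ is normal in $W_\Gamma$ if and only if the following two conditions hold. (N1) For every $s\in V\setminus\Delta$ there is an edge of $\Omega$ incident to $B$ with label $s$. (N2) For every vertex $v$ of $\Omega$ there is a label-preserving graph isomorphism from $C(\Omega,B)$ to $C(\Omega,v)$ that takes $B$ to $v$. -/

import Mathlib

/-! Right-angled Coxeter groups, cube complexes labeled by the vertices of a simplicial graph,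
completions of subgroups, and core graphs. -/

universe u w w'

namespace RACG

/-! ### Right-angled Coxeter groups -/

section Group

variable {V : Type u}

open Classical in
/-- The Coxeter matrix of the right-angled Coxeter group of `Γ`: `m(s,t)` is `1` if `s = t`, `2` if
`s` and `t` are adjacent, and infinite (which is encoded by `0`) otherwise. -/
noncomputable def coxeterMatrix (Γ : SimpleGraph V) : CoxeterMatrix V where
  M := Matrix.of fun s t => if s = t then 1 else if Γ.Adj s t then 2 else 0
  isSymm := by
    ext s t
    simp only [Matrix.transpose_apply, Matrix.of_apply, eq_comm (a := t), Γ.adj_comm t s]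
  diagonal s := by simp
  off_diagonal s t h := by
    simp only [Matrix.of_apply, if_neg h]
    split_ifs <;> decide

/-- The right-angled Coxeter group
`W_Γ = ⟨V | s² = 1 for s ∈ V, (s t)² = 1 for s, t adjacent in Γ⟩`. -/
abbrev W (Γ : SimpleGraph V) : Type u := (coxeterMatrix Γ).Group

/-- `W_Γ` with its standard generators. -/
noncomputable abbrev sys (Γ : SimpleGraph V) : CoxeterSystem (coxeterMatrix Γ) (W Γ) :=
  (coxeterMatrix Γ).toCoxeterSystem

/-- The set `Δ` of the vertices of `Γ` that, as elements of `W_Γ`, commute with every element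
of `G`. -/
def commutingGenerators {Γ : SimpleGraph V} (G : Subgroup (W Γ)) : Set V :=
  {s | ∀ g ∈ G, (sys Γ).simple s * g = g * (sys Γ).simple s}

end Group

/-! ### Labeled graphs -/

/-- A graph (loops and multiple edges are allowed) whose edges are labeled by elements of `V`.
It is given by its vertices and its oriented edges. An (unoriented) edge is a pair `{e, rev e}`. -/
structure LabeledGraph (V : Type u) where
  Vertex : Type w
  OEdge : Type w
  src : OEdge → Vertex
  rev : OEdge → OEdge
  label : OEdge → V
  rev_rev : ∀ e, rev (rev e) = e
  rev_ne : ∀ e, rev e ≠ e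
  label_rev : ∀ e, label (rev e) = label e

namespace LabeledGraph

variable {V : Type u} (X : LabeledGraph.{u, w} V)

/-- The terminal vertex of an oriented edge. -/
def tgt (e : X.OEdge) : X.Vertex := X.src (X.rev e)

/-- `X.IsPath x p y`: the oriented edges in the list `p` form, in this order, a path (possibly with
backtracking) from `x` to `y`. The list `[]` is the path of length zero at `x = y`. -/
def IsPath : X.Vertex → List X.OEdge → X.Vertex → Prop
  | x, [], y => x = y
  | x, e :: p, y => X.src e = x ∧ IsPath (X.tgt e) p y

/-- The label of a path, a word in the letters `V`. -/
def word (p : List X.OEdge) : List V := p.map X.label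

/-- An isomorphism of labeled graphs: bijections on vertices and on oriented edges which respect
incidence, orientation reversal and labels. -/
structure Iso (X : LabeledGraph.{u, w} V) (Y : LabeledGraph.{u, w'} V) where
  vertex : X.Vertex ≃ Y.Vertex
  oedge : X.OEdge ≃ Y.OEdge
  map_src : ∀ e, Y.src (oedge e) = vertex (X.src e)
  map_rev : ∀ e, Y.rev (oedge e) = oedge (X.rev e)
  map_label : ∀ e, Y.label (oedge e) = X.label e

end LabeledGraph

/-! ### Cube complexes -/

/-- An isometry of the cube `[-1/2,1/2]^m` onto a face of the cube `[-1/2,1/2]^n`.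
The corners of `[-1/2,1/2]^n` are the functions `Fin n → Bool`. The map sends the corner
`(false, …, false)` to the corner `base` and the `i`-th coordinate direction to the direction
`dir i`. -/
@[ext]
structure CubeMap (m n : ℕ) where
  base : Fin n → Bool
  dir : Fin m ↪ Fin n

namespace CubeMap

/-- The effect of the isometry on corners: the coordinate `dir i` of the image of `x` is
`base (dir i) + x i` (mod 2), and the coordinates that are not in the range of `dir` are those of
`base`. -/
noncomputable def onCorner {m n : ℕ} (f : CubeMap m n) (x : Fin m → Bool) : Fin n → Bool :=
  fun j => xor (f.base j) (Function.extend f.dir x (fun _ => false) j)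

/-- The identity of a cube. -/
def id (n : ℕ) : CubeMap n n := ⟨fun _ => false, Function.Embedding.refl _⟩

/-- The composition `f ∘ g`. -/
noncomputable def comp {l m n : ℕ} (f : CubeMap m n) (g : CubeMap l m) : CubeMap l n :=
  ⟨f.onCorner g.base, g.dir.trans f.dir⟩

/-- The inclusion of a corner. -/
def corner {n : ℕ} (x : Fin n → Bool) : CubeMap 0 n := ⟨x, Function.Embedding.ofIsEmpty⟩

/-- The reversal of the interval. -/
def flip : CubeMap 1 1 := ⟨fun _ => true, Function.Embedding.refl _⟩

end CubeMap

/-- A cube complex, i.e. a cell complex whose cells are cubes and in which the attaching map of a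
cube carries every face isometrically onto a cube. `Cell n` is the set of the *parametrized*
`n`-cubes: pairs of an `n`-cube of the complex and an isometric identification of it with
`[-1/2,1/2]^n` (in other words, the characteristic map of the cube, up to the symmetries of
`[-1/2,1/2]^n`). The map `face f` restricts a parametrization along `f`. The symmetries of the
standard cube permute the parametrizations of every cube freely, and a cube is an orbit. Faces of a
cube may be identified with each other. -/
structure CubeComplex where
  Cell : ℕ → Type w
  face : ∀ {m n : ℕ}, CubeMap m n → Cell n → Cell m
  face_id : ∀ {n : ℕ} (c : Cell n), face (CubeMap.id n) c = c
  face_comp : ∀ {l m n : ℕ} (f : CubeMap m n) (g : CubeMap l m) (c : Cell n),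
    face (f.comp g) c = face g (face f c)
  face_free : ∀ {n : ℕ} (g : CubeMap n n) (c : Cell n), face g c = c → g = CubeMap.id n

namespace CubeComplex

variable (X : CubeComplex.{w})

/-- Two parametrizations of the same cube. -/
def SameCube {n : ℕ} (c d : X.Cell n) : Prop := ∃ g : CubeMap n n, X.face g c = d

/-- The cubes of `c` and `d` have equal boundaries: for suitable parametrizations of the two cubes,
the restrictions to every proper face agree. -/
def SameBoundary {n : ℕ} (c d : X.Cell n) : Prop :=
  ∃ g : CubeMap n n, ∀ m < n, ∀ f : CubeMap m n, X.face f (X.face g c) = X.face f d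

end CubeComplex

/-- A `Γ`-labeled cube complex. The edges are labeled by vertices of `Γ`, any two edges of a cube
that are dual to the same midcube have equal labels (in particular, as the case `n = 1` shows, the
label of an edge does not depend on its parametrization), and the labels of the edges of a cube
at any one corner are distinct and pairwise adjacent in `Γ`. -/
structure LabeledCubeComplex {V : Type u} (Γ : SimpleGraph V) extends CubeComplex.{w} where
  label : Cell 1 → V
  label_parallel : ∀ {n : ℕ} (c : Cell n) (f g : CubeMap 1 n), f.dir 0 = g.dir 0 →
    label (face f c) = label (face g c)
  label_adj : ∀ {n : ℕ} (c : Cell n) (f g : CubeMap 1 n), f.base = g.base → f.dir 0 ≠ g.dir 0 →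
    Γ.Adj (label (face f c)) (label (face g c))

namespace LabeledCubeComplex

variable {V : Type u} {Γ : SimpleGraph V} (Ω : LabeledCubeComplex.{u, w} Γ)

/-- The 1-skeleton. -/
def skeleton : LabeledGraph.{u, w} V where
  Vertex := Ω.Cell 0
  OEdge := Ω.Cell 1
  src e := Ω.face (CubeMap.corner fun _ => false) e
  rev e := Ω.face CubeMap.flip e
  label := Ω.label
  rev_rev e := by
    rw [← Ω.face_comp]
    have h : CubeMap.flip.comp CubeMap.flip = CubeMap.id 1 := by
      refine CubeMap.ext (funext fun j => ?_) rfl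
      have : Function.extend (CubeMap.flip.dir) (fun _ => true) (fun _ => false) j = true :=
        CubeMap.flip.dir.injective.extend_apply (fun _ => true) (fun _ => false) j
      simp only [CubeMap.comp, CubeMap.onCorner, CubeMap.id]
      change xor true (Function.extend (CubeMap.flip.dir) (fun _ => true) (fun _ => false) j)
        = false
      rw [this]; rfl
    rw [h, Ω.face_id]
  rev_ne e h := by
    have := congrFun (congrArg CubeMap.base (Ω.face_free _ _ h)) 0
    exact Bool.noConfusion this
  label_rev e := by
    conv_rhs => rw [← Ω.face_id e]
    exact Ω.label_parallel e _ _ rfl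

/-- Vertices of `Ω`. -/
abbrev Vertex : Type w := Ω.skeleton.Vertex

/-- Oriented edges of `Ω`. -/
abbrev OEdge : Type w := Ω.skeleton.OEdge

/-- `Ω` is connected: any two vertices are joined by a path. -/
def IsConnected : Prop := Nonempty Ω.Vertex ∧ ∀ x y : Ω.Vertex, ∃ p, Ω.skeleton.IsPath x p y

/-- `Ω` is folded: no fold operation is possible (there are no two distinct edges with a common
endpoint and with the same label) and no cube identification operation is possible (there are no
two distinct cubes of dimension at least two with equal boundaries). -/
def IsFolded : Prop :=
  (∀ e f : Ω.OEdge, Ω.skeleton.src e = Ω.skeleton.src f →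
    Ω.skeleton.label e = Ω.skeleton.label f → f = e ∨ f = Ω.skeleton.rev e) ∧
  (∀ n : ℕ, 2 ≤ n → ∀ c d : Ω.Cell n, Ω.SameBoundary c d → Ω.SameCube c d)

/-- `Ω` is cube-full: any `n` edges at a vertex whose labels form an `n`-clique in `Γ` are edges of
a common `n`-cube. -/
def IsCubeFull : Prop :=
  ∀ (n : ℕ) (x : Ω.Vertex) (e : Fin n → Ω.OEdge), (∀ i, Ω.skeleton.src (e i) = x) →
    (∀ i j, i ≠ j → Γ.Adj (Ω.skeleton.label (e i)) (Ω.skeleton.label (e j))) →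
    ∃ c : Ω.Cell n, ∀ i, ∃ f : CubeMap 1 n, Ω.face f c = e i

/-- `(Ω, B)` is a completion of the subgroup `G` of `W_Γ`. -/
structure IsCompletion (B : Ω.Vertex) (G : Subgroup (W Γ)) : Prop where
  connected : Ω.IsConnected
  folded : Ω.IsFolded
  cubeFull : Ω.IsCubeFull
  loop_mem : ∀ p, Ω.skeleton.IsPath B p B → (sys Γ).wordProd (Ω.skeleton.word p) ∈ G
  exists_loop : ∀ ω : List V, (sys Γ).IsReduced ω → (sys Γ).wordProd ω ∈ G →
    ∃ p, Ω.skeleton.IsPath B p B ∧ Ω.skeleton.word p = ω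

/-- `p` is a loop based at `v` whose label is a reduced word. -/
def IsReducedLoop (v : Ω.Vertex) (p : List Ω.OEdge) : Prop :=
  Ω.skeleton.IsPath v p v ∧ (sys Γ).IsReduced (Ω.skeleton.word p)

/-- The core graph `C(Ω, v)`: the union of all the loops based at `v` whose labels are reduced
words. Its vertices are the vertices on such loops, its edges are the edges traversed by them. -/
def core (v : Ω.Vertex) : LabeledGraph.{u, w} V where
  Vertex := {x : Ω.Vertex // ∃ p q, Ω.IsReducedLoop v (p ++ q) ∧ Ω.skeleton.IsPath v p x}
  OEdge := {e : Ω.OEdge // ∃ p, Ω.IsReducedLoop v p ∧ (e ∈ p ∨ Ω.skeleton.rev e ∈ p)}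
  src e := ⟨Ω.skeleton.src e.1, by
    have key : ∀ (p : List Ω.OEdge) (x y : Ω.Vertex) (f : Ω.OEdge), Ω.skeleton.IsPath x p y →
        f ∈ p → ∃ a b, p = a ++ f :: b ∧ Ω.skeleton.IsPath x a (Ω.skeleton.src f) ∧
          Ω.skeleton.IsPath x (a ++ [f]) (Ω.skeleton.tgt f) := by
      intro p
      induction p with
      | nil => intro x y f _ hf; simp at hf
      | cons e' p ih =>
        intro x y f hp hf
        rcases List.mem_cons.1 hf with rfl | hf
        · exact ⟨[], p, rfl, hp.1.symm, hp.1, rfl⟩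
        · obtain ⟨a, b, hab, h1, h2⟩ := ih _ y f hp.2 hf
          exact ⟨e' :: a, b, by rw [hab]; rfl, ⟨hp.1, h1⟩, ⟨hp.1, h2⟩⟩
    obtain ⟨p, hp, he | he⟩ := e.2
    · obtain ⟨a, b, hab, h1, -⟩ := key p v v _ hp.1 he
      exact ⟨a, e.1 :: b, hab ▸ hp, h1⟩
    · obtain ⟨a, b, hab, -, h2⟩ := key p v v _ hp.1 he
      refine ⟨a ++ [Ω.skeleton.rev e.1], b, ?_, ?_⟩
      · have : a ++ [Ω.skeleton.rev e.1] ++ b = p := by rw [hab]; simp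
        rw [this]; exact hp
      · rwa [LabeledGraph.tgt, Ω.skeleton.rev_rev] at h2⟩
  rev e := ⟨Ω.skeleton.rev e.1, by
    obtain ⟨p, hp, he⟩ := e.2
    refine ⟨p, hp, ?_⟩
    rw [Ω.skeleton.rev_rev]
    exact he.symm⟩
  label e := Ω.skeleton.label e.1
  rev_rev e := Subtype.ext (Ω.skeleton.rev_rev e.1)
  rev_ne e h := Ω.skeleton.rev_ne e.1 (congrArg Subtype.val h)
  label_rev e := Ω.skeleton.label_rev e.1

/-- The vertex `v` of `C(Ω, v)`. -/
def coreBase (v : Ω.Vertex) : (Ω.core v).Vertex :=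
  ⟨v, [], [], ⟨rfl, by simp [CoxeterSystem.IsReduced, LabeledGraph.word]⟩, rfl⟩

end LabeledCubeComplex

end RACG

/-! The engine is Tits's solution of the word problem: a word in `W Γ` becomes reduced by exchanging
neighbouring commuting letters and deleting repeated neighbours, never by insertion. `Red.shuffle`
proves this by letting `W Γ` act on shuffle classes of words without cancellation;
`rel_of_isReduced` packages it as an induction principle. In a folded cube-full complex both moves
can be made on paths with fixed endpoints: exchanges go across squares (`IsCubeFull.square`), and by
foldedness a repeated letter is backtracking or goes twice around an edge that joins a vertex to
itself. Insertion may fail, since edges may be missing, and is never needed (`reach_of_isReduced`).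

Suppose that G is normal. Conjugation by s carries loops along an edge labeled s, so by
connectedness the loops at every vertex represent G just as those at B do
(`LoopsRepresent.of_reach`). A core graph is determined by this information: a core vertex is a
place at which a reduced loop is cut, and two cuts give the same vertex exactly when a loop label
decides so (`LoopsRepresent.endpoint_eq`). This gives (N2). For (N1), if no loop with reduced label
at B begins with s, then comparing ω with sωs shows that s commutes with G
(`mem_commutingGenerators`).

Conversely, for s outside Δ, take an edge labeled s from B to v. By (N2) a loop at B with reduced
label ω has a copy at v, and going along the edge, around the copy and back gives a loop at B with
label sωs. Hence G is stable under conjugation by generators. -/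

namespace RACG

/-! ### The word problem in right-angled Coxeter groups -/

section Words

variable {V : Type u} (Γ : SimpleGraph V)

/-- Two words are shuffle equivalent if they differ by a sequence of exchanges of consecutive
adjacent letters. -/
inductive Shuffle : List V → List V → Prop
  | refl (l : List V) : Shuffle l l
  | swap {a b : V} (h : Γ.Adj a b) (l : List V) : Shuffle (a :: b :: l) (b :: a :: l)
  | cons (a : V) {l m : List V} : Shuffle l m → Shuffle (a :: l) (a :: m)
  | trans {l m k : List V} : Shuffle l m → Shuffle m k → Shuffle l k

/-- `Front Γ s l l'`: the letter `s` can be moved to the front of `l` by shuffling, and `l'` is the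
rest of the word. -/
inductive Front (s : V) : List V → List V → Prop
  | head (l : List V) : Front s (s :: l) l
  | tail {t : V} {l l' : List V} : Γ.Adj s t → Front s l l' → Front s (t :: l) (t :: l')

/-- No letter of the word cancels against a later one after shuffling. -/
def Red : List V → Prop
  | [] => True
  | s :: l => (∀ l', ¬ Front Γ s l l') ∧ Red l

variable {Γ}

theorem Shuffle.symm {l m : List V} (h : Shuffle Γ l m) : Shuffle Γ m l := by
  induction h with
  | refl l => exact .refl l
  | swap h l => exact .swap h.symm l
  | cons a _ ih => exact .cons a ih
  | trans _ _ ih₁ ih₂ => exact .trans ih₂ ih₁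

theorem Shuffle.length_eq {l m : List V} (h : Shuffle Γ l m) : l.length = m.length := by
  induction h with
  | refl l => rfl
  | swap h l => rfl
  | cons a _ ih => simp [ih]
  | trans _ _ ih₁ ih₂ => exact ih₁.trans ih₂

/-- No letter is adjacent to itself, so only the first occurrence of `s` can reach the front. -/
theorem Front.unique {s : V} {l l₁ l₂ : List V} (h₁ : Front Γ s l l₁) (h₂ : Front Γ s l l₂) :
    l₁ = l₂ := by
  induction h₁ generalizing l₂ with
  | head l =>
    cases h₂ with
    | head => rfl
    | tail h _ => exact (Γ.irrefl h).elim
  | tail h _ ih =>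
    cases h₂ with
    | head => exact (Γ.irrefl h).elim
    | tail _ h' => rw [ih h']

theorem Front.shuffle {s : V} {l l' : List V} (h : Front Γ s l l') : Shuffle Γ l (s :: l') := by
  induction h with
  | head l => exact .refl _
  | tail h _ ih => exact (ih.cons _).trans (.swap h.symm _)

/-- Makes cancellation against the front letter well defined on shuffle classes. -/
theorem Shuffle.front {l m : List V} (h : Shuffle Γ l m) {s : V} {l' : List V}
    (hf : Front Γ s l l') : ∃ m', Front Γ s m m' ∧ Shuffle Γ l' m' := by
  induction h generalizing l' with
  | refl l => exact ⟨l', hf, .refl _⟩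
  | swap h l =>
    cases hf with
    | head => exact ⟨_, .tail h (.head l), .refl _⟩
    | tail hs hf =>
      cases hf with
      | head => exact ⟨_, .head _, .refl _⟩
      | tail ht hf => exact ⟨_, .tail ht (.tail hs hf), .swap h _⟩
  | cons a h ih =>
    cases hf with
    | head => exact ⟨_, .head _, h⟩
    | tail hs hf =>
      obtain ⟨m', h₁, h₂⟩ := ih hf
      exact ⟨_, .tail hs h₁, h₂.cons a⟩
  | trans _ _ ih₁ ih₂ =>
    obtain ⟨m', h₁, h₂⟩ := ih₁ hf
    obtain ⟨k', h₃, h₄⟩ := ih₂ h₁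
    exact ⟨k', h₃, h₂.trans h₄⟩

theorem Shuffle.not_front {l m : List V} (h : Shuffle Γ l m) {s : V}
    (hf : ∀ l', ¬ Front Γ s l l') (m' : List V) : ¬ Front Γ s m m' := fun hm =>
  let ⟨l', hl, _⟩ := h.symm.front hm
  hf l' hl

theorem Shuffle.red {l m : List V} (h : Shuffle Γ l m) (hl : Red Γ l) : Red Γ m := by
  induction h with
  | refl l => exact hl
  | @swap a b h l =>
    obtain ⟨ha, hb, hl⟩ := hl
    refine ⟨fun l' hf => ?_, fun l' hf => ha _ (.tail h hf), hl⟩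
    cases hf with
    | head => exact Γ.irrefl h
    | tail _ hf => exact hb _ hf
  | cons a h ih => exact ⟨h.not_front hl.1, ih hl.2⟩
  | trans _ _ ih₁ ih₂ => exact ih₂ (ih₁ hl)

theorem Red.cons {s : V} {l : List V} (h : ∀ l', ¬ Front Γ s l l') (hl : Red Γ l) :
    Red Γ (s :: l) := ⟨h, hl⟩

theorem Front.red {s : V} {l l' : List V} (h : Front Γ s l l') (hl : Red Γ l) : Red Γ l' :=
  (h.shuffle.red hl).2

theorem Front.not_front {s : V} {l l' : List V} (h : Front Γ s l l') (hl : Red Γ l) :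
    ∀ m, ¬ Front Γ s l' m := (h.shuffle.red hl).1

/-! ### The action of the group on shuffle classes -/

variable (Γ) in
/-- Shuffle equivalence of the words without cancellation. -/
def shuffleSetoid : Setoid {l : List V // Red Γ l} where
  r l m := Shuffle Γ l.1 m.1
  iseqv := ⟨fun _ => .refl _, fun h => h.symm, fun h₁ h₂ => h₁.trans h₂⟩

variable (Γ) in
/-- Words without cancellation, up to shuffles. -/
abbrev ShuffleClass : Type u := Quotient (shuffleSetoid Γ)

/-- The class of a word. -/
def ShuffleClass.mk (l : List V) (h : Red Γ l) : ShuffleClass Γ := Quotient.mk _ ⟨l, h⟩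

theorem ShuffleClass.mk_eq {l m : List V} {hl : Red Γ l} {hm : Red Γ m} :
    mk l hl = mk m hm ↔ Shuffle Γ l m := Quotient.eq

open Classical in
/-- Left multiplication of a class by a letter, which is cancelled if possible. -/
noncomputable def ShuffleClass.act (s : V) : ShuffleClass Γ → ShuffleClass Γ :=
  Quotient.lift (fun l => if h : ∃ l', Front Γ s l.1 l' then mk h.choose (h.choose_spec.red l.2)
      else mk (s :: l.1) (.cons (not_exists.1 h) l.2)) fun l m hlm => by
    have hlm : Shuffle Γ l.1 m.1 := hlm
    by_cases h : ∃ l', Front Γ s l.1 l'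
    · obtain ⟨l', hl⟩ := h
      obtain ⟨m', hm, h⟩ := hlm.front hl
      have h₁ : ∃ l', Front Γ s l.1 l' := ⟨l', hl⟩
      have h₂ : ∃ l', Front Γ s m.1 l' := ⟨m', hm⟩
      rw [dif_pos h₁, dif_pos h₂, mk_eq, h₁.choose_spec.unique hl, h₂.choose_spec.unique hm]
      exact h
    · have h' : ¬ ∃ l', Front Γ s m.1 l' := not_exists.2 (hlm.not_front (not_exists.1 h))
      rw [dif_neg h, dif_neg h', mk_eq]
      exact hlm.cons s

theorem ShuffleClass.act_of_front {s : V} {l l' : List V} (hl : Red Γ l) (h : Front Γ s l l') :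
    act s (mk l hl) = mk l' (h.red hl) := by
  have h' : ∃ l', Front Γ s l l' := ⟨l', h⟩
  refine (dif_pos h').trans ?_
  rw [mk_eq, h'.choose_spec.unique h]
  exact .refl _

theorem ShuffleClass.act_of_not_front {s : V} {l : List V} (hl : Red Γ l)
    (h : ∀ l', ¬ Front Γ s l l') : act s (mk l hl) = mk (s :: l) (.cons h hl) :=
  dif_neg (not_exists.2 h)

theorem ShuffleClass.act_act_self (s : V) (c : ShuffleClass Γ) : act s (act s c) = c := by
  obtain ⟨⟨l, hl⟩⟩ := c
  change act s (act s (mk l hl)) = mk l hl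
  by_cases h : ∃ l', Front Γ s l l'
  · obtain ⟨l', h⟩ := h
    rw [act_of_front hl h, act_of_not_front _ (h.not_front hl), mk_eq]
    exact h.shuffle.symm
  · rw [act_of_not_front hl (not_exists.1 h), act_of_front _ (.head l)]

theorem ShuffleClass.act_comm {s t : V} (hst : Γ.Adj s t) (c : ShuffleClass Γ) :
    act s (act t c) = act t (act s c) := by
  have tail_iff : ∀ {a b : V} (_ : Γ.Adj a b) {l : List V}, (∀ l', ¬ Front Γ a l l') →
      ∀ l', ¬ Front Γ a (b :: l) l' := by
    intro a b hab l h l' hf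
    cases hf with
    | head => exact Γ.irrefl hab
    | tail _ hf => exact h _ hf
  have mixed : ∀ {a b : V} (_ : Γ.Adj a b) {l l' : List V} (hl : Red Γ l) (_ : Front Γ a l l')
      (_ : ∀ m, ¬ Front Γ b l m), act a (act b (mk l hl)) = act b (act a (mk l hl)) := by
    intro a b hab l l' hl h₁ h₂
    rw [act_of_front hl h₁, act_of_not_front hl h₂, act_of_front _ (h₁.tail hab),
      act_of_not_front]
    exact fun m hm => h₁.shuffle.not_front h₂ _ (hm.tail hab.symm)
  obtain ⟨⟨l, hl⟩⟩ := c
  change act s (act t (mk l hl)) = act t (act s (mk l hl))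
  by_cases h₁ : ∃ l', Front Γ s l l' <;> by_cases h₂ : ∃ l', Front Γ t l l'
  -- Both letters cancel. After `s` is removed, `t` can still reach the front, leaving `l₃`;
  -- removing them in the other order leaves a shuffle of `l₃`.
  · obtain ⟨l₁, h₁⟩ := h₁
    obtain ⟨l₂, h₂⟩ := h₂
    obtain ⟨m, hm, h⟩ := h₁.shuffle.front h₂
    cases hm with
    | head => exact (Γ.irrefl hst).elim
    | @tail _ _ l₃ _ hm =>
      obtain ⟨m, hm', h'⟩ := h.symm.front (.head l₃)
      rw [act_of_front hl h₁, act_of_front hl h₂, act_of_front _ hm', act_of_front _ hm, mk_eq]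
      exact h'.symm
  · exact mixed hst hl h₁.choose_spec (not_exists.1 h₂)
  · exact (mixed hst.symm hl h₂.choose_spec (not_exists.1 h₁)).symm
  · have h₁ := not_exists.1 h₁
    have h₂ := not_exists.1 h₂
    rw [act_of_not_front hl h₁, act_of_not_front hl h₂,
      act_of_not_front _ (tail_iff hst h₁), act_of_not_front _ (tail_iff hst.symm h₂), mk_eq]
    exact .swap hst l

/-- Left multiplication by a letter as an element of the monoid of self-maps. -/
noncomputable def letterEnd (s : V) : Function.End (ShuffleClass Γ) := ShuffleClass.act s

theorem letterEnd_mul_self (s : V) :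
    (letterEnd s * letterEnd s : Function.End (ShuffleClass Γ)) = 1 :=
  funext (ShuffleClass.act_act_self s)

theorem letterEnd_comm {s t : V} (h : Γ.Adj s t) :
    (letterEnd s * letterEnd t : Function.End (ShuffleClass Γ)) = letterEnd t * letterEnd s :=
  funext (ShuffleClass.act_comm h)

theorem coxeterMatrix_of_adj {s t : V} (h : Γ.Adj s t) : (coxeterMatrix Γ) s t = 2 := by
  classical
  exact (if_neg h.ne).trans (if_pos h)

theorem coxeterMatrix_of_not_adj {s t : V} (h : s ≠ t) (h' : ¬ Γ.Adj s t) :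
    (coxeterMatrix Γ) s t = 0 := by
  classical
  exact (if_neg h).trans (if_neg h')

-- Distinct non-adjacent letters impose no relation: their order is encoded as `0`, and the power is
-- trivially `1`.
variable (Γ) in
theorem isLiftable_letterEnd : (coxeterMatrix Γ).IsLiftable
    (letterEnd : V → Function.End (ShuffleClass Γ)) := by
  intro s t
  by_cases h : s = t
  · rw [h, (coxeterMatrix Γ).diagonal, pow_one, letterEnd_mul_self]
  by_cases h' : Γ.Adj s t
  · rw [coxeterMatrix_of_adj h', pow_two]
    nth_rewrite 2 [letterEnd_comm h']
    rw [mul_assoc, ← mul_assoc (letterEnd t), letterEnd_mul_self, one_mul, letterEnd_mul_self]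
  · rw [coxeterMatrix_of_not_adj h h', pow_zero]

variable (Γ) in
/-- The action of `W_Γ` on the classes of words without cancellation. -/
noncomputable def actHom : W Γ →* Function.End (ShuffleClass Γ) :=
  (sys Γ).lift ⟨_, isLiftable_letterEnd Γ⟩

theorem actHom_cons (s : V) (ω : List V) (c : ShuffleClass Γ) :
    actHom Γ ((sys Γ).wordProd (s :: ω)) c =
      ShuffleClass.act s (actHom Γ ((sys Γ).wordProd ω) c) := by
  have h : actHom Γ ((sys Γ).simple s) = letterEnd s :=
    CoxeterSystem.lift_apply_simple _ (isLiftable_letterEnd Γ) s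
  rw [CoxeterSystem.wordProd_cons, map_mul, h]
  rfl

/-- Starting from the empty word, the letters of `ω` pile up without ever cancelling, so the group
element remembers the class of `ω`. -/
theorem actHom_of_red {ω : List V} (h : Red Γ ω) :
    actHom Γ ((sys Γ).wordProd ω) (.mk [] trivial) = .mk ω h := by
  induction ω with
  | nil => rw [CoxeterSystem.wordProd_nil, map_one]; rfl
  | cons s ω ih => rw [actHom_cons, ih h.2, ShuffleClass.act_of_not_front h.2 h.1]

theorem Red.shuffle {ω ω' : List V} (h : Red Γ ω) (h' : Red Γ ω')
    (e : (sys Γ).wordProd ω = (sys Γ).wordProd ω') : Shuffle Γ ω ω' := by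
  rw [← ShuffleClass.mk_eq (hl := h) (hm := h'), ← actHom_of_red, ← actHom_of_red, e]

theorem simple_comm {s t : V} (h : Γ.Adj s t) :
    (sys Γ).simple s * (sys Γ).simple t = (sys Γ).simple t * (sys Γ).simple s := by
  have h₁ := (sys Γ).simple_mul_simple_pow s t
  rw [coxeterMatrix_of_adj h, pow_two, mul_eq_one_iff_eq_inv, mul_inv_rev, CoxeterSystem.inv_simple,
    CoxeterSystem.inv_simple] at h₁
  exact h₁

theorem Shuffle.wordProd_eq {l m : List V} (h : Shuffle Γ l m) :
    (sys Γ).wordProd l = (sys Γ).wordProd m := by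
  induction h with
  | refl l => rfl
  | swap h l => simp only [CoxeterSystem.wordProd_cons, ← mul_assoc, simple_comm h]
  | cons a _ ih => simp only [CoxeterSystem.wordProd_cons, ih]
  | trans _ _ ih₁ ih₂ => exact ih₁.trans ih₂

/-! ### Reduced words -/

theorem red_of_isReduced {ω : List V} (h : (sys Γ).IsReduced ω) : Red Γ ω := by
  induction ω with
  | nil => trivial
  | cons s ω ih =>
    refine ⟨fun l' hf => ?_, ih (h.drop 1)⟩
    have h₁ := hf.shuffle.length_eq
    have h₂ := (sys Γ).length_wordProd_le l'
    have h₃ : (sys Γ).wordProd (s :: ω) = (sys Γ).wordProd l' := by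
      rw [CoxeterSystem.wordProd_cons, hf.shuffle.wordProd_eq, CoxeterSystem.wordProd_cons,
        CoxeterSystem.simple_mul_simple_cancel_left]
    rw [← h₃, h.eq] at h₂
    simp only [List.length_cons] at h₁ h₂
    omega

/-- A word without cancellation is a shuffle of any reduced word for the same element, and shuffles
preserve length. -/
theorem isReduced_iff_red {ω : List V} : (sys Γ).IsReduced ω ↔ Red Γ ω := by
  refine ⟨red_of_isReduced, fun h => ?_⟩
  obtain ⟨ω', h', e⟩ := (sys Γ).exists_isReduced ((sys Γ).wordProd ω)
  rw [CoxeterSystem.IsReduced, e, h'.eq, (h.shuffle (red_of_isReduced h') e).length_eq]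

/-- Any preorder on words that is compatible with adding letters in front, contains the exchange of
adjacent letters and the cancellation of a repeated letter, relates a word to all the reduced words
for the same element. -/
theorem rel_of_isReduced {r : List V → List V → Prop} (hrefl : ∀ l, r l l)
    (htrans : ∀ {l m k}, r l m → r m k → r l k) (hcons : ∀ a {l m}, r l m → r (a :: l) (a :: m))
    (hswap : ∀ {a b}, Γ.Adj a b → ∀ l, r (a :: b :: l) (b :: a :: l))
    (hcancel : ∀ a l, r (a :: a :: l) l) {ω ω' : List V} (h : (sys Γ).IsReduced ω')
    (e : (sys Γ).wordProd ω = (sys Γ).wordProd ω') : r ω ω' := by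
  have of_shuffle : ∀ {l m}, Shuffle Γ l m → r l m := by
    intro l m h
    induction h with
    | refl l => exact hrefl l
    | swap h l => exact hswap h l
    | cons a _ ih => exact hcons a ih
    | trans _ _ ih₁ ih₂ => exact htrans ih₁ ih₂
  -- Normalize from the right: each new front letter either stays or meets an equal letter brought
  -- forward by shuffles and is cancelled. Only shortening moves occur, so `r` need not be
  -- symmetric.
  have key : ∀ ω, ∃ m, Red Γ m ∧ (sys Γ).wordProd ω = (sys Γ).wordProd m ∧ r ω m := by
    intro ω
    induction ω with
    | nil => exact ⟨[], trivial, rfl, hrefl _⟩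
    | cons s ω ih =>
      obtain ⟨m, hm, e, hr⟩ := ih
      by_cases hf : ∃ m', Front Γ s m m'
      · obtain ⟨m', hf⟩ := hf
        refine ⟨m', hf.red hm, ?_, htrans (hcons s (htrans hr (of_shuffle hf.shuffle)))
          (hcancel s m')⟩
        rw [CoxeterSystem.wordProd_cons, e, hf.shuffle.wordProd_eq, CoxeterSystem.wordProd_cons,
          CoxeterSystem.simple_mul_simple_cancel_left]
      · refine ⟨s :: m, ⟨not_exists.1 hf, hm⟩, ?_, hcons s hr⟩
        rw [CoxeterSystem.wordProd_cons, e, CoxeterSystem.wordProd_cons]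
  obtain ⟨m, hm, em, hr⟩ := key ω
  exact htrans hr (of_shuffle (hm.shuffle (red_of_isReduced h) (em.symm.trans e)))

/-- The letter that reaches the front can only be the final `s`, which passes through all of `ω`. -/
theorem Front.eq_of_append_singleton {s : V} {ω l : List V} (h : ∀ l', ¬ Front Γ s ω l')
    (hf : Front Γ s (ω ++ [s]) l) : l = ω := by
  induction ω generalizing l with
  | nil => exact hf.unique (.head [])
  | cons t ω ih =>
    cases hf with
    | head => exact (h _ (.head ω)).elim
    | tail hst hf => rw [ih (fun l' hl => h _ (hl.tail hst)) hf]

/-- If no reduced word for an element of the normal subgroup `G` begins with `s`, then `s` commutes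
with `G`. -/
theorem mem_commutingGenerators {G : Subgroup (W Γ)} (hG : G.Normal) {s : V}
    (hs : ∀ ω, (sys Γ).IsReduced (s :: ω) → (sys Γ).wordProd (s :: ω) ∉ G) :
    s ∈ commutingGenerators G := by
  have not_front : ∀ {ω}, (sys Γ).IsReduced ω → (sys Γ).wordProd ω ∈ G →
      ∀ l', ¬ Front Γ s ω l' := fun {ω} h hm l' hf =>
    hs l' (isReduced_iff_red.2 (hf.shuffle.red (red_of_isReduced h))) (hf.shuffle.wordProd_eq ▸ hm)
  intro g hg
  obtain ⟨ω, hω, rfl⟩ := (sys Γ).exists_isReduced g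
  -- The reversed word represents the inverse, which is also in `G`, so `s` cannot be moved to its
  -- front.
  have h₁ : Red Γ (ω ++ [s]) := by
    rw [← isReduced_iff_red, ← CoxeterSystem.isReduced_reverse_iff, List.reverse_append,
      isReduced_iff_red]
    exact ⟨not_front hω.reverse (by simpa using hg), red_of_isReduced hω.reverse⟩
  -- Otherwise `s :: (ω ++ [s])` would be a reduced word beginning with `s`, and by normality it
  -- represents an element of `G`.
  have h₂ : ∃ l, Front Γ s (ω ++ [s]) l := by
    by_contra h
    refine hs (ω ++ [s]) (isReduced_iff_red.2 ⟨not_exists.1 h, h₁⟩) ?_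
    rw [CoxeterSystem.wordProd_cons, CoxeterSystem.wordProd_append, CoxeterSystem.wordProd_singleton,
      ← mul_assoc]
    simpa only [CoxeterSystem.inv_simple] using hG.conj_mem _ hg ((sys Γ).simple s)
  obtain ⟨l, hl⟩ := h₂
  have := hl.shuffle.wordProd_eq
  rw [hl.eq_of_append_singleton (not_front hω hg)] at this
  simpa [CoxeterSystem.wordProd_cons, CoxeterSystem.wordProd_append] using this.symm

end Words

end RACG

namespace RACG

/-! ### Paths and isomorphisms of labeled graphs -/

namespace LabeledGraph

variable {V : Type u} {X : LabeledGraph.{u, w} V} {Y : LabeledGraph.{u, w'} V}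

theorem tgt_rev (e : X.OEdge) : X.tgt (X.rev e) = X.src e := congrArg X.src (X.rev_rev e)

theorem isPath_append {x y : X.Vertex} {p q : List X.OEdge} :
    X.IsPath x (p ++ q) y ↔ ∃ z, X.IsPath x p z ∧ X.IsPath z q y := by
  induction p generalizing x with
  | nil => simp [IsPath]
  | cons e p ih => simp [IsPath, ih, and_assoc]

variable (X) in
/-- There is a path from `x` to `y` with label `ω`. -/
def Reach (x : X.Vertex) (ω : List V) (y : X.Vertex) : Prop := ∃ p, X.IsPath x p y ∧ X.word p = ω

variable (X) in
/-- There is an oriented edge from `x` to `y` with label `s`. -/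
def HasEdge (x : X.Vertex) (s : V) (y : X.Vertex) : Prop :=
  ∃ e, X.src e = x ∧ X.label e = s ∧ X.tgt e = y

variable (X) in
/-- No two distinct edges with a common endpoint have the same label. -/
def Folded : Prop :=
  ∀ e f : X.OEdge, X.src e = X.src f → X.label e = X.label f → f = e ∨ f = X.rev e

theorem HasEdge.symm {x y : X.Vertex} {s : V} (h : X.HasEdge x s y) : X.HasEdge y s x := by
  obtain ⟨e, h₁, h₂, h₃⟩ := h
  exact ⟨X.rev e, h₃, (X.label_rev e).trans h₂, (tgt_rev e).trans h₁⟩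

theorem Reach.refl (x : X.Vertex) : X.Reach x [] x := ⟨[], rfl, rfl⟩

@[simp]
theorem reach_nil {x y : X.Vertex} : X.Reach x [] y ↔ x = y := by
  refine ⟨?_, fun h => h ▸ .refl x⟩
  rintro ⟨p, hp, hw⟩
  obtain rfl := List.map_eq_nil_iff.1 hw
  exact hp

theorem reach_cons {x y : X.Vertex} {s : V} {ω : List V} :
    X.Reach x (s :: ω) y ↔ ∃ z, X.HasEdge x s z ∧ X.Reach z ω y := by
  constructor
  · rintro ⟨p, hp, hw⟩
    obtain ⟨e, p, rfl, he, hw⟩ := List.map_eq_cons_iff.1 hw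
    exact ⟨_, ⟨e, hp.1, he, rfl⟩, p, hp.2, hw⟩
  · rintro ⟨z, ⟨e, h₁, h₂, rfl⟩, p, hp, hw⟩
    exact ⟨e :: p, ⟨h₁, hp⟩, List.map_eq_cons_iff.2 ⟨e, p, rfl, h₂, hw⟩⟩

theorem reach_singleton {x y : X.Vertex} {s : V} : X.Reach x [s] y ↔ X.HasEdge x s y := by
  simp [reach_cons]

theorem reach_append {x y : X.Vertex} {ω ω' : List V} :
    X.Reach x (ω ++ ω') y ↔ ∃ z, X.Reach x ω z ∧ X.Reach z ω' y := by
  induction ω generalizing x with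
  | nil => simp
  | cons s ω ih =>
    simp only [List.cons_append, reach_cons, ih]
    exact ⟨fun ⟨a, h, b, h', h''⟩ => ⟨b, ⟨a, h, h'⟩, h''⟩, fun ⟨b, ⟨a, h, h'⟩, h''⟩ => ⟨a, h, b, h', h''⟩⟩

theorem Reach.reverse {x y : X.Vertex} {ω : List V} (h : X.Reach x ω y) :
    X.Reach y ω.reverse x := by
  induction ω generalizing x with
  | nil => exact reach_nil.2 (reach_nil.1 h).symm
  | cons s ω ih =>
    obtain ⟨z, h₁, h₂⟩ := reach_cons.1 h
    rw [List.reverse_cons]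
    exact reach_append.2 ⟨z, ih h₂, reach_singleton.2 h₁.symm⟩

/-- If `f` is the reverse of `e`, the common source forces the edge to join a vertex to itself. -/
theorem Folded.tgt_eq (hX : X.Folded) {e f : X.OEdge} (h : X.src e = X.src f)
    (h' : X.label e = X.label f) : X.tgt e = X.tgt f := by
  rcases hX e f h h' with rfl | rfl
  · rfl
  · rw [tgt_rev]; exact h.symm

theorem Folded.hasEdge_unique (hX : X.Folded) {x y z : X.Vertex} {s : V} (h : X.HasEdge x s y)
    (h' : X.HasEdge x s z) : y = z := by
  obtain ⟨e, h₁, h₂, rfl⟩ := h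
  obtain ⟨f, h₃, h₄, rfl⟩ := h'
  exact hX.tgt_eq (h₁.trans h₃.symm) (h₂.trans h₄.symm)

theorem Folded.reach_unique (hX : X.Folded) {x y z : X.Vertex} {ω : List V} (h : X.Reach x ω y)
    (h' : X.Reach x ω z) : y = z := by
  induction ω generalizing x with
  | nil => exact (reach_nil.1 h).symm.trans (reach_nil.1 h')
  | cons s ω ih =>
    obtain ⟨a, h₁, h₂⟩ := reach_cons.1 h
    obtain ⟨b, h₃, h₄⟩ := reach_cons.1 h'
    obtain rfl := hX.hasEdge_unique h₁ h₃
    exact ih h₂ h₄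

theorem Iso.isPath (φ : Iso X Y) {x y : X.Vertex} {p : List X.OEdge} (h : X.IsPath x p y) :
    Y.IsPath (φ.vertex x) (p.map φ.oedge) (φ.vertex y) := by
  induction p generalizing x with
  | nil => exact congrArg φ.vertex h
  | cons e p ih =>
    refine ⟨(φ.map_src e).trans (congrArg φ.vertex h.1), ?_⟩
    rw [tgt, φ.map_rev, φ.map_src]
    exact ih h.2

theorem Iso.word_map (φ : Iso X Y) (p : List X.OEdge) : Y.word (p.map φ.oedge) = X.word p := by
  simp [word, φ.map_label]

theorem Iso.reach (φ : Iso X Y) {x y : X.Vertex} {ω : List V} (h : X.Reach x ω y) :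
    Y.Reach (φ.vertex x) ω (φ.vertex y) := by
  obtain ⟨p, hp, rfl⟩ := h
  exact ⟨_, φ.isPath hp, φ.word_map p⟩

/-! ### Isomorphisms of folded graphs from bijections of vertices -/

/-- The edge `e` is the chosen one among the oriented edges with the same initial vertex and the
same label. In a folded graph this chooses an orientation of every edge from a vertex to itself. -/
def IsChosen (e : X.OEdge) : Prop :=
  ∃ h : ∃ c, X.src c = X.src e ∧ X.label c = X.label e, h.choose = e

theorem exists_isChosen (e : X.OEdge) :
    ∃ c, X.src c = X.src e ∧ X.label c = X.label e ∧ IsChosen c := by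
  have h : ∃ c, X.src c = X.src e ∧ X.label c = X.label e := ⟨e, rfl, rfl⟩
  refine ⟨h.choose, h.choose_spec.1, h.choose_spec.2, ⟨_, rfl, rfl⟩, ?_⟩
  -- The choice depends only on the predicate, which is the same for `e` and for the chosen edge.
  congr 1
  ext c
  rw [h.choose_spec.1, h.choose_spec.2]

theorem IsChosen.unique {e f : X.OEdge} (he : IsChosen e) (hf : IsChosen f)
    (h : X.src e = X.src f) (h' : X.label e = X.label f) : e = f := by
  obtain ⟨h₁, he⟩ := he
  obtain ⟨h₂, hf⟩ := hf
  rw [← he, ← hf]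
  congr 1
  ext c
  rw [h, h']

theorem Folded.isChosen (hX : X.Folded) {e : X.OEdge} (h : X.src e ≠ X.tgt e) : IsChosen e := by
  obtain ⟨c, h₁, h₂, hc⟩ := exists_isChosen e
  rcases hX e c h₁.symm h₂.symm with rfl | rfl
  · exact hc
  · exact (h h₁.symm).elim

/-- Source and label cannot tell apart the two orientations of an edge from a vertex to itself;
exactly one of them is chosen, which breaks the tie. -/
theorem Folded.isChosen_rev (hX : X.Folded) {e : X.OEdge} (h : X.src e = X.tgt e) :
    IsChosen (X.rev e) ↔ ¬ IsChosen e := by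
  refine ⟨fun h₁ h₂ => X.rev_ne e (h₁.unique h₂ h.symm (X.label_rev e)), fun h₁ => ?_⟩
  obtain ⟨c, h₂, h₃, hc⟩ := exists_isChosen e
  rcases hX e c h₂.symm h₃.symm with rfl | rfl
  · exact (h₁ hc).elim
  · exact hc

theorem Folded.eq_of_isChosen_iff (hX : X.Folded) {e f : X.OEdge} (h : X.src e = X.src f)
    (h' : X.label e = X.label f) (hc : IsChosen e ↔ IsChosen f) : e = f := by
  rcases hX e f h h' with rfl | rfl
  · rfl
  · have := hX.isChosen_rev (e := e) h
    tauto

/-- The oriented edges `e` and `f` correspond to each other under the bijection `φ` of vertices. -/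
def EdgeCorr (φ : X.Vertex ≃ Y.Vertex) (e : X.OEdge) (f : Y.OEdge) : Prop :=
  Y.src f = φ (X.src e) ∧ Y.label f = X.label e ∧ Y.tgt f = φ (X.tgt e) ∧ (IsChosen e ↔ IsChosen f)

theorem EdgeCorr.symm {φ : X.Vertex ≃ Y.Vertex} {e : X.OEdge} {f : Y.OEdge}
    (h : EdgeCorr φ e f) : EdgeCorr φ.symm f e := by
  obtain ⟨h₁, h₂, h₃, h₄⟩ := h
  exact ⟨by simp [h₁], h₂.symm, by simp [h₃], h₄.symm⟩

theorem EdgeCorr.unique {φ : X.Vertex ≃ Y.Vertex} (hY : Y.Folded) {e : X.OEdge} {f f' : Y.OEdge}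
    (h : EdgeCorr φ e f) (h' : EdgeCorr φ e f') : f = f' :=
  hY.eq_of_isChosen_iff (h.1.trans h'.1.symm) (h.2.1.trans h'.2.1.symm)
    (h.2.2.2.symm.trans h'.2.2.2)

theorem EdgeCorr.rev {φ : X.Vertex ≃ Y.Vertex} (hX : X.Folded) (hY : Y.Folded) {e : X.OEdge}
    {f : Y.OEdge} (h : EdgeCorr φ e f) : EdgeCorr φ (X.rev e) (Y.rev f) := by
  obtain ⟨h₁, h₂, h₃, h₄⟩ := h
  refine ⟨h₃, by rw [X.label_rev, Y.label_rev, h₂], by rw [tgt_rev, tgt_rev, h₁], ?_⟩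
  by_cases he : X.src e = X.tgt e
  · rw [hX.isChosen_rev he, hY.isChosen_rev (by rw [h₁, h₃, he]), h₄]
  · have hf : Y.src f ≠ Y.tgt f := by rwa [h₁, h₃, φ.injective.ne_iff]
    refine iff_of_true (hX.isChosen ?_) (hY.isChosen ?_)
    · rw [tgt_rev]; exact fun h => he h.symm
    · rw [tgt_rev]; exact fun h => hf h.symm

theorem exists_edgeCorr {φ : X.Vertex ≃ Y.Vertex} (hX : X.Folded) (hY : Y.Folded)
    (h : ∀ x s y, X.HasEdge x s y → Y.HasEdge (φ x) s (φ y)) (e : X.OEdge) :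
    ∃ f, EdgeCorr φ e f := by
  obtain ⟨f, h₁, h₂, h₃⟩ := h _ _ _ ⟨e, rfl, rfl, rfl⟩
  by_cases hc : IsChosen e ↔ IsChosen f
  · exact ⟨f, h₁, h₂, h₃, hc⟩
  -- With distinct endpoints both edges would be chosen. So a mismatch occurs only at an edge from a
  -- vertex to itself, and reversing `f` repairs it.
  have hf : Y.src f = Y.tgt f := by
    by_contra hf
    refine hc (iff_of_true (hX.isChosen fun he => hf ?_) (hY.isChosen hf))
    rw [h₁, h₃, he]
  refine ⟨Y.rev f, (hf.symm.trans h₁ :), (Y.label_rev f).trans h₂, ?_, ?_⟩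
  · rw [tgt_rev, hf, h₃]
  · rw [hY.isChosen_rev hf]; tauto

/-- A bijection between the vertices of folded graphs that respects labeled adjacency extends to an
isomorphism. -/
theorem Folded.exists_iso (hX : X.Folded) (hY : Y.Folded) (φ : X.Vertex ≃ Y.Vertex)
    (h : ∀ x s y, X.HasEdge x s y ↔ Y.HasEdge (φ x) s (φ y)) :
    ∃ ψ : Iso X Y, ψ.vertex = φ := by
  choose f hf using exists_edgeCorr (φ := φ) hX hY fun x s y => (h x s y).1
  choose g hg using exists_edgeCorr (φ := φ.symm) hY hX fun x s y hxy => by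
    rw [h]; simpa using hxy
  exact ⟨{ vertex := φ
           oedge := ⟨f, g, fun e => (hg (f e)).unique hX (hf e).symm,
             fun e => (hf (g e)).unique hY (hg e).symm⟩
           map_src := fun e => (hf e).1
           map_rev := fun e => ((hf e).rev hX hY).unique hY (hf _)
           map_label := fun e => (hf e).2.1 }, rfl⟩

end LabeledGraph

end RACG

namespace RACG

/-! ### Folded and cube-full complexes -/

namespace LabeledCubeComplex

open LabeledGraph

variable {V : Type u} {Γ : SimpleGraph V} {Ω : LabeledCubeComplex.{u, w} Γ}

theorem face_corner {m n : ℕ} (f : CubeMap m n) (x : Fin m → Bool) (c : Ω.Cell n) :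
    Ω.face (CubeMap.corner x) (Ω.face f c) = Ω.face (CubeMap.corner (f.onCorner x)) c := by
  rw [← Ω.face_comp]
  congr 1
  exact CubeMap.ext rfl (Function.Embedding.ext fun i => i.elim0)

theorem onCorner_of_eq {n : ℕ} (f : CubeMap 1 n) (b : Bool) :
    f.onCorner (fun _ => b) = fun j => xor (f.base j) (b && decide (j = f.dir 0)) := by
  funext j
  rw [CubeMap.onCorner]
  congr 1
  by_cases h : j = f.dir 0
  · rw [h, f.dir.injective.extend_apply]; simp
  · rw [Function.extend_apply']
    · simp [h]
    · rintro ⟨i, rfl⟩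
      exact h (congrArg f.dir (Subsingleton.elim i 0))

theorem src_face {n : ℕ} (f : CubeMap 1 n) (c : Ω.Cell n) :
    Ω.skeleton.src (Ω.face f c) = Ω.face (CubeMap.corner f.base) c := by
  refine (face_corner f _ c).trans ?_
  rw [onCorner_of_eq]
  simp

theorem tgt_face {n : ℕ} (f : CubeMap 1 n) (c : Ω.Cell n) :
    Ω.skeleton.tgt (Ω.face f c) =
      Ω.face (CubeMap.corner fun j => xor (f.base j) (decide (j = f.dir 0))) c := by
  have h : CubeMap.flip.onCorner (fun _ => false) = fun _ => true := by
    rw [onCorner_of_eq]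
    simp [CubeMap.flip]
  refine (face_corner CubeMap.flip _ (Ω.face f c)).trans ?_
  rw [h, face_corner, onCorner_of_eq]
  simp

/-- The edge of the standard cube from the corner `b` in the direction `d`. -/
def cubeEdge {n : ℕ} (b : Fin n → Bool) (d : Fin n) : CubeMap 1 n :=
  ⟨b, ⟨fun _ => d, Function.injective_of_subsingleton _⟩⟩

theorem hasEdge_cubeEdge {n : ℕ} (b : Fin n → Bool) (d : Fin n) (c : Ω.Cell n) (f : CubeMap 1 n)
    (hf : f.dir 0 = d) : Ω.skeleton.HasEdge (Ω.face (CubeMap.corner b) c)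
      (Ω.skeleton.label (Ω.face f c))
      (Ω.face (CubeMap.corner fun j => xor (b j) (decide (j = d))) c) :=
  ⟨Ω.face (cubeEdge b d) c, src_face _ c, Ω.label_parallel c _ _ hf.symm, tgt_face _ c⟩

theorem IsFolded.skeleton (h : Ω.IsFolded) : Ω.skeleton.Folded := h.1

/-- The two edges at the middle vertex `y` lie in a square, and the corner opposite to `y` is the
required `y'`. -/
theorem IsCubeFull.square (h : Ω.IsCubeFull) (hf : Ω.IsFolded) {s t : V} (hst : Γ.Adj s t)
    {x y z : Ω.Vertex} (h₁ : Ω.skeleton.HasEdge x s y) (h₂ : Ω.skeleton.HasEdge y t z) :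
    ∃ y', Ω.skeleton.HasEdge x t y' ∧ Ω.skeleton.HasEdge y' s z := by
  obtain ⟨e₁, hs₁, rfl, ht₁⟩ := h₁.symm
  obtain ⟨e₂, hs₂, rfl, ht₂⟩ := h₂
  have hadj : ∀ i j : Fin 2, i ≠ j →
      Γ.Adj (Ω.skeleton.label (![e₁, e₂] i)) (Ω.skeleton.label (![e₁, e₂] j)) := by
    intro i j hij
    fin_cases i <;> fin_cases j
    · exact (hij rfl).elim
    · exact hst
    · exact hst.symm
    · exact (hij rfl).elim
  obtain ⟨c, hc⟩ := h 2 y ![e₁, e₂] (fun i => by fin_cases i <;> assumption) hadj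
  obtain ⟨f₁, rfl⟩ : ∃ f, Ω.face f c = e₁ := hc 0
  obtain ⟨f₂, rfl⟩ : ∃ f, Ω.face f c = e₂ := hc 1
  set b := f₁.base
  set d₁ := f₁.dir 0
  set d₂ := f₂.dir 0
  have hy : Ω.face (CubeMap.corner b) c = y := (src_face f₁ c).symm.trans hs₁
  have hx : Ω.face (CubeMap.corner fun j => xor (b j) (decide (j = d₁))) c = x :=
    (tgt_face f₁ c).symm.trans ht₁
  have hz := hasEdge_cubeEdge b d₂ c f₂ rfl
  rw [hy] at hz
  -- The face `f₂` need not start at the corner `b`, but the parallel edge at `b` has the same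
  -- label, so by foldedness it also ends at `z`.
  have hz := hf.skeleton.hasEdge_unique hz ⟨_, hs₂, rfl, ht₂⟩
  have h₃ := hasEdge_cubeEdge (fun j => xor (b j) (decide (j = d₁))) d₂ c f₂ rfl
  have h₄ := hasEdge_cubeEdge (fun j => xor (b j) (decide (j = d₂))) d₁ c f₁ rfl
  rw [hx] at h₃
  rw [hz] at h₄
  refine ⟨_, h₃, ?_⟩
  simp only [Bool.xor_right_comm _ (decide (_ = d₁))]
  exact h₄.symm

/-- In a folded cube-full complex, paths can be shortened to paths with reduced labels. -/
theorem reach_of_isReduced (hf : Ω.IsFolded) (hc : Ω.IsCubeFull) {ω ω' : List V}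
    (h : (sys Γ).IsReduced ω') (e : (sys Γ).wordProd ω = (sys Γ).wordProd ω') {x y : Ω.Vertex}
    (hr : Ω.skeleton.Reach x ω y) : Ω.skeleton.Reach x ω' y := by
  refine rel_of_isReduced
    (r := fun l m => ∀ x y, Ω.skeleton.Reach x l y → Ω.skeleton.Reach x m y)
    (fun _ _ _ h => h) (fun h h' x y hl => h' x y (h x y hl)) ?_ ?_ ?_ h e x y hr
  · intro a l m h x y hl
    obtain ⟨z, h₁, h₂⟩ := reach_cons.1 hl
    exact reach_cons.2 ⟨z, h₁, h z y h₂⟩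
  · intro a b hab l x y hl
    obtain ⟨z, h₁, hl⟩ := reach_cons.1 hl
    obtain ⟨z', h₂, hl⟩ := reach_cons.1 hl
    obtain ⟨z'', h₃, h₄⟩ := hc.square hf hab h₁ h₂
    exact reach_cons.2 ⟨z'', h₃, reach_cons.2 ⟨z', h₄, hl⟩⟩
  · intro a l x y hl
    obtain ⟨z, h₁, hl⟩ := reach_cons.1 hl
    obtain ⟨z', h₂, hl⟩ := reach_cons.1 hl
    rwa [hf.skeleton.hasEdge_unique h₁.symm h₂]

/-! ### Labels of loops -/

/-- The labels of the loops at `v` represent elements of `G`, and every reduced word for an element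
of `G` is the label of a loop at `v`. -/
def LoopsRepresent (v : Ω.Vertex) (G : Subgroup (W Γ)) : Prop :=
  (∀ ω, Ω.skeleton.Reach v ω v → (sys Γ).wordProd ω ∈ G) ∧
    ∀ ω, (sys Γ).IsReduced ω → (sys Γ).wordProd ω ∈ G → Ω.skeleton.Reach v ω v

theorem IsCompletion.loopsRepresent {B : Ω.Vertex} {G : Subgroup (W Γ)} (h : Ω.IsCompletion B G) :
    LoopsRepresent B G := by
  refine ⟨?_, h.exists_loop⟩
  rintro ω ⟨p, hp, rfl⟩
  exact h.loop_mem p hp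

/-- Loops at `y` become loops at `x` by going along the edge and back, which conjugates labels by
`s`; normality keeps them in `G`. In the other direction the label obtained may be unreduced, and
the path is then replaced by one with the given reduced label. -/
theorem LoopsRepresent.hasEdge (hf : Ω.IsFolded) (hc : Ω.IsCubeFull) {G : Subgroup (W Γ)}
    (hG : G.Normal) {x y : Ω.Vertex} {s : V} (hx : LoopsRepresent x G)
    (h : Ω.skeleton.HasEdge x s y) : LoopsRepresent y G := by
  have conj : ∀ g, (sys Γ).simple s * g * (sys Γ).simple s ∈ G ↔ g ∈ G := by
    intro g
    rw [hG.mem_comm_iff, CoxeterSystem.simple_mul_simple_cancel_left]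
  refine ⟨fun ω hω => ?_, fun ω hω hm => ?_⟩
  · rw [← conj]
    have := hx.1 (s :: (ω ++ [s]))
      (reach_cons.2 ⟨y, h, reach_append.2 ⟨y, hω, reach_singleton.2 h.symm⟩⟩)
    simpa only [CoxeterSystem.wordProd_cons, CoxeterSystem.wordProd_append,
      CoxeterSystem.wordProd_nil, mul_one, mul_assoc] using this
  · obtain ⟨ω', hω', e⟩ := (sys Γ).exists_isReduced
      ((sys Γ).simple s * (sys Γ).wordProd ω * (sys Γ).simple s)
    have hl := hx.2 ω' hω' (e ▸ (conj _).2 hm)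
    refine reach_of_isReduced hf hc (ω := s :: (ω' ++ [s])) hω ?_
      (reach_cons.2 ⟨x, h.symm, reach_append.2 ⟨x, hl, reach_singleton.2 h⟩⟩)
    rw [CoxeterSystem.wordProd_cons, CoxeterSystem.wordProd_append, ← e,
      CoxeterSystem.wordProd_singleton]
    simp only [mul_assoc, CoxeterSystem.simple_mul_simple_self, mul_one,
      CoxeterSystem.simple_mul_simple_cancel_left]

theorem LoopsRepresent.of_reach (hf : Ω.IsFolded) (hc : Ω.IsCubeFull) {G : Subgroup (W Γ)}
    (hG : G.Normal) {x y : Ω.Vertex} {ω : List V} (hx : LoopsRepresent x G)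
    (h : Ω.skeleton.Reach x ω y) : LoopsRepresent y G := by
  induction ω generalizing x with
  | nil => rwa [← reach_nil.1 h]
  | cons s ω ih =>
    obtain ⟨z, h₁, h₂⟩ := reach_cons.1 h
    exact ih (hx.hasEdge hf hc hG h₁) h₂

/-- Whether two paths from the base vertex end at the same vertex depends only on the labels of the
loops. -/
theorem LoopsRepresent.endpoint_eq (hf : Ω.IsFolded) (hc : Ω.IsCubeFull) {G : Subgroup (W Γ)}
    {v v' x y y' : Ω.Vertex} (hv : LoopsRepresent v G) (hv' : LoopsRepresent v' G)
    {ω ω' : List V} (hω : (sys Γ).IsReduced ω) (h₁ : Ω.skeleton.Reach v ω x)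
    (h₂ : Ω.skeleton.Reach v ω' x) (h₁' : Ω.skeleton.Reach v' ω y)
    (h₂' : Ω.skeleton.Reach v' ω' y') : y = y' := by
  have hm := hv.1 _ (reach_append.2 ⟨x, h₁, h₂.reverse⟩)
  obtain ⟨r, hr, e⟩ := (sys Γ).exists_isReduced ((sys Γ).wordProd (ω ++ ω'.reverse))
  -- At `v'` go around the loop `r`, then along `ω'` to `y'`. This label represents the same element
  -- as `ω`, so `ω` also leads from `v'` to `y'`.
  refine hf.skeleton.reach_unique h₁' (reach_of_isReduced hf hc (ω := r ++ ω') hω ?_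
    (reach_append.2 ⟨v', hv'.2 r hr (e ▸ hm), h₂'⟩))
  rw [CoxeterSystem.wordProd_append, ← e, CoxeterSystem.wordProd_append,
    CoxeterSystem.wordProd_reverse, inv_mul_cancel_right]

/-! ### Core graphs -/

/-- The words `a` and `b` are read along the two parts into which the vertex `x` divides a loop at `v`
with reduced label. -/
def Divides (v x : Ω.Vertex) (a b : List V) : Prop :=
  (sys Γ).IsReduced (a ++ b) ∧ Ω.skeleton.Reach v a x ∧ Ω.skeleton.Reach x b v

theorem Divides.reduced_left {v x : Ω.Vertex} {a b : List V} (h : Divides v x a b) :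
    (sys Γ).IsReduced a := by
  simpa using h.1.take a.length

theorem Divides.exists_path {v x : Ω.Vertex} {a b : List V} (h : Divides v x a b) :
    ∃ p q, Ω.IsReducedLoop v (p ++ q) ∧ Ω.skeleton.IsPath v p x := by
  obtain ⟨hr, ⟨p, hp, rfl⟩, ⟨q, hq, rfl⟩⟩ := h
  refine ⟨p, q, ⟨isPath_append.2 ⟨x, hp, hq⟩, ?_⟩, hp⟩
  rwa [word, List.map_append]

theorem exists_divides (hf : Ω.IsFolded) {v : Ω.Vertex} (x : (Ω.core v).Vertex) :
    ∃ a b, Divides v x.1 a b := by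
  obtain ⟨x, p, q, ⟨hp, hr⟩, hx⟩ := x
  obtain ⟨z, h₁, h₂⟩ := isPath_append.1 hp
  obtain rfl : z = x := hf.skeleton.reach_unique ⟨p, h₁, rfl⟩ ⟨p, hx, rfl⟩
  refine ⟨Ω.skeleton.word p, Ω.skeleton.word q, ?_, ⟨p, hx, rfl⟩, ⟨q, h₂, rfl⟩⟩
  rwa [word, List.map_append] at hr

theorem core_folded (hf : Ω.IsFolded) (v : Ω.Vertex) : (Ω.core v).Folded := by
  intro e f h h'
  exact (hf.skeleton e.1 f.1 (congrArg Subtype.val h) h').imp Subtype.ext Subtype.ext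

theorem core_hasEdge_iff {v : Ω.Vertex} {s : V} {x y : (Ω.core v).Vertex} :
    (Ω.core v).HasEdge x s y ↔ ∃ a b, (sys Γ).IsReduced (a ++ s :: b) ∧
      Ω.skeleton.Reach v a x.1 ∧ Ω.skeleton.HasEdge x.1 s y.1 ∧ Ω.skeleton.Reach y.1 b v := by
  constructor
  · rintro ⟨⟨e, p, ⟨hp, hr⟩, he⟩, rfl, rfl, rfl⟩
    change ∃ a b, (sys Γ).IsReduced (a ++ Ω.skeleton.label e :: b) ∧
      Ω.skeleton.Reach v a (Ω.skeleton.src e) ∧ Ω.skeleton.HasEdge (Ω.skeleton.src e)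
        (Ω.skeleton.label e) (Ω.skeleton.tgt e) ∧ Ω.skeleton.Reach (Ω.skeleton.tgt e) b v
    have key : ∀ f ∈ p, ∃ a b, (sys Γ).IsReduced (a ++ Ω.skeleton.label f :: b) ∧
        Ω.skeleton.Reach v a (Ω.skeleton.src f) ∧ Ω.skeleton.Reach (Ω.skeleton.tgt f) b v := by
      intro f hfp
      obtain ⟨p₁, p₂, rfl⟩ := List.append_of_mem hfp
      obtain ⟨z, h₁, rfl, h₂⟩ := isPath_append.1 hp
      refine ⟨Ω.skeleton.word p₁, Ω.skeleton.word p₂, ?_, ⟨p₁, h₁, rfl⟩, ⟨p₂, h₂, rfl⟩⟩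
      rwa [word, List.map_append, List.map_cons] at hr
    rcases he with he | he
    · obtain ⟨a, b, h₁, h₂, h₃⟩ := key _ he
      exact ⟨a, b, h₁, h₂, ⟨e, rfl, rfl, rfl⟩, h₃⟩
    -- The loop traverses the edge backwards; the reversed loop, whose label is again reduced,
    -- traverses it forwards.
    · obtain ⟨a, b, h₁, h₂, h₃⟩ := key _ he
      rw [tgt_rev] at h₃
      refine ⟨b.reverse, a.reverse, ?_, h₃.reverse, ⟨e, rfl, rfl, rfl⟩, h₂.reverse⟩
      rw [Ω.skeleton.label_rev] at h₁
      simpa using h₁.reverse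
  · rintro ⟨a, b, hr, ⟨p, hp, rfl⟩, ⟨e, h₁, rfl, h₂⟩, ⟨q, hq, rfl⟩⟩
    refine ⟨⟨e, p ++ e :: q, ⟨isPath_append.2 ⟨x.1, hp, h₁, h₂ ▸ hq⟩, ?_⟩, .inl (by simp)⟩,
      Subtype.ext h₁, rfl, Subtype.ext h₂⟩
    rwa [word, List.map_append, List.map_cons]

/-- The vertices `x` and `x'` are reached from `v` and `v'` by paths with the same label, which can
be completed to loops with the same reduced label. -/
def CoreCorr (v v' x x' : Ω.Vertex) : Prop := ∃ a b, Divides v x a b ∧ Divides v' x' a b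

theorem CoreCorr.symm {v v' x x' : Ω.Vertex} (h : CoreCorr v v' x x') : CoreCorr v' v x' x := by
  obtain ⟨a, b, h, h'⟩ := h
  exact ⟨a, b, h', h⟩

theorem CoreCorr.unique (hf : Ω.IsFolded) (hc : Ω.IsCubeFull) {G : Subgroup (W Γ)}
    {v v' x y y' : Ω.Vertex} (hv : LoopsRepresent v G) (hv' : LoopsRepresent v' G)
    (h : CoreCorr v v' x y) (h' : CoreCorr v v' x y') : y = y' := by
  obtain ⟨a, b, h₁, h₂⟩ := h
  obtain ⟨a', b', h₁', h₂'⟩ := h'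
  exact hv.endpoint_eq hf hc hv' h₁.reduced_left h₁.2.1 h₁'.2.1 h₂.2.1 h₂'.2.1

/-- The same reduced words label loops at `v` and at `v'`, so the whole loop can be read at `v'` and
cut after `a`. -/
theorem Divides.exists_divides {G : Subgroup (W Γ)} {v v' x : Ω.Vertex} (hv : LoopsRepresent v G)
    (hv' : LoopsRepresent v' G) {a b : List V} (h : Divides v x a b) : ∃ y, Divides v' y a b := by
  obtain ⟨y, h₁, h₂⟩ := reach_append.1
    (hv'.2 _ h.1 (hv.1 _ (reach_append.2 ⟨x, h.2.1, h.2.2⟩)))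
  exact ⟨y, h.1, h₁, h₂⟩

theorem exists_coreCorr (hf : Ω.IsFolded) {G : Subgroup (W Γ)} {v v' : Ω.Vertex}
    (hv : LoopsRepresent v G) (hv' : LoopsRepresent v' G) (x : (Ω.core v).Vertex) :
    ∃ y : (Ω.core v').Vertex, CoreCorr v v' x.1 y.1 := by
  obtain ⟨a, b, h⟩ := LabeledCubeComplex.exists_divides hf x
  obtain ⟨y, hy⟩ := h.exists_divides hv hv'
  exact ⟨⟨y, hy.exists_path⟩, a, b, h, hy⟩

/-- A reduced loop through the edge is copied at `v'`. Cutting the copy just before and just after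
`s` gives `x'` and `y'`, by uniqueness of corresponding vertices. -/
theorem core_hasEdge_of_coreCorr (hf : Ω.IsFolded) (hc : Ω.IsCubeFull) {G : Subgroup (W Γ)}
    {v v' : Ω.Vertex} (hv : LoopsRepresent v G) (hv' : LoopsRepresent v' G)
    {x y : (Ω.core v).Vertex} {x' y' : (Ω.core v').Vertex} (hx : CoreCorr v v' x.1 x'.1)
    (hy : CoreCorr v v' y.1 y'.1) {s : V} (h : (Ω.core v).HasEdge x s y) :
    (Ω.core v').HasEdge x' s y' := by
  obtain ⟨a, b, hr, ha, hs, hb⟩ := core_hasEdge_iff.1 h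
  have hr' : (sys Γ).IsReduced ((a ++ [s]) ++ b) := by simpa using hr
  have hl : Ω.skeleton.Reach v (a ++ s :: b) v :=
    reach_append.2 ⟨x.1, ha, reach_cons.2 ⟨y.1, hs, hb⟩⟩
  obtain ⟨x₁, h₁, h₂⟩ := reach_append.1 (hv'.2 _ hr (hv.1 _ hl))
  obtain ⟨y₁, h₂, h₃⟩ := reach_cons.1 h₂
  obtain rfl : x₁ = x'.1 := CoreCorr.unique hf hc hv hv'
    ⟨a, s :: b, ⟨hr, ha, reach_cons.2 ⟨y.1, hs, hb⟩⟩, ⟨hr, h₁, reach_cons.2 ⟨y₁, h₂, h₃⟩⟩⟩ hx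
  obtain rfl : y₁ = y'.1 := CoreCorr.unique hf hc hv hv'
    ⟨a ++ [s], b, ⟨hr', reach_append.2 ⟨x.1, ha, reach_singleton.2 hs⟩, hb⟩,
      ⟨hr', reach_append.2 ⟨x'.1, h₁, reach_singleton.2 h₂⟩, h₃⟩⟩ hy
  exact core_hasEdge_iff.2 ⟨a, b, hr, h₁, h₂, h₃⟩

/-- The core graphs at two vertices with the same labels of reduced loops are isomorphic. -/
theorem exists_core_iso (hf : Ω.IsFolded) (hc : Ω.IsCubeFull) {G : Subgroup (W Γ)}
    {v v' : Ω.Vertex} (hv : LoopsRepresent v G) (hv' : LoopsRepresent v' G) :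
    ∃ φ : Iso (Ω.core v) (Ω.core v'), φ.vertex (Ω.coreBase v) = Ω.coreBase v' := by
  choose f hff using exists_coreCorr hf hv hv'
  choose g hg using exists_coreCorr hf hv' hv
  let φ : (Ω.core v).Vertex ≃ (Ω.core v').Vertex :=
    ⟨f, g, fun x => Subtype.ext ((hg (f x)).unique hf hc hv' hv (hff x).symm),
      fun y => Subtype.ext ((hff (g y)).unique hf hc hv hv' (hg y).symm)⟩
  obtain ⟨ψ, hψ⟩ := (core_folded hf v).exists_iso (core_folded hf v') φ fun x s y =>
    ⟨core_hasEdge_of_coreCorr hf hc hv hv' (hff x) (hff y),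
      core_hasEdge_of_coreCorr hf hc hv' hv (hff x).symm (hff y).symm⟩
  refine ⟨ψ, ?_⟩
  rw [hψ]
  -- The base vertices correspond through the loop of length zero.
  have hnil : (sys Γ).IsReduced ([] ++ []) := by simp [CoxeterSystem.IsReduced]
  exact Subtype.ext ((hff _).unique hf hc hv hv'
    ⟨[], [], ⟨hnil, .refl _, .refl _⟩, ⟨hnil, .refl _, .refl _⟩⟩)

/-! ### Paths in the core graph and in the complex -/

theorem isPath_of_core {v : Ω.Vertex} {x y : (Ω.core v).Vertex} {p : List (Ω.core v).OEdge}
    (h : (Ω.core v).IsPath x p y) : Ω.skeleton.IsPath x.1 (p.map Subtype.val) y.1 := by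
  induction p generalizing x with
  | nil => exact congrArg Subtype.val h
  | cons e p ih => exact ⟨congrArg Subtype.val h.1, ih h.2⟩

theorem core_isPath {v : Ω.Vertex} {x y : (Ω.core v).Vertex} {p : List (Ω.core v).OEdge}
    (h : Ω.skeleton.IsPath x.1 (p.map Subtype.val) y.1) : (Ω.core v).IsPath x p y := by
  induction p generalizing x with
  | nil => exact Subtype.ext h
  | cons e p ih => exact ⟨Subtype.ext h.1, ih h.2⟩

theorem core_reach_of_isReduced {v : Ω.Vertex} {ω : List V} (hω : (sys Γ).IsReduced ω)
    (h : Ω.skeleton.Reach v ω v) : (Ω.core v).Reach (Ω.coreBase v) ω (Ω.coreBase v) := by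
  obtain ⟨p, hp, rfl⟩ := h
  have hmem : ∀ e ∈ p, ∃ p, Ω.IsReducedLoop v p ∧ (e ∈ p ∨ Ω.skeleton.rev e ∈ p) :=
    fun e he => ⟨p, ⟨hp, hω⟩, .inl he⟩
  obtain ⟨q, rfl⟩ : ∃ q : List (Ω.core v).OEdge, q.map Subtype.val = p :=
    ⟨p.attachWith _ hmem, List.attachWith_map_subtype_val hmem⟩
  exact ⟨q, core_isPath hp, (List.map_map (f := Subtype.val) (g := Ω.skeleton.label)).symm⟩

theorem reach_of_core {v : Ω.Vertex} {x y : (Ω.core v).Vertex} {ω : List V}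
    (h : (Ω.core v).Reach x ω y) : Ω.skeleton.Reach x.1 ω y.1 := by
  obtain ⟨p, hp, rfl⟩ := h
  exact ⟨_, isPath_of_core hp, List.map_map⟩

end LabeledCubeComplex

/-! ### Normality and the main theorem -/

theorem normal_of_simple_conj_mem {V : Type u} {Γ : SimpleGraph V} {G : Subgroup (W Γ)}
    (h : ∀ s, ∀ g ∈ G, (sys Γ).simple s * g * (sys Γ).simple s ∈ G) : G.Normal := by
  refine ⟨fun g hg w => ?_⟩
  obtain ⟨ω, rfl⟩ := (sys Γ).wordProd_surjective w
  induction ω with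
  | nil => simpa using hg
  | cons s ω ih =>
    have := h s _ ih
    rwa [CoxeterSystem.wordProd_cons, mul_inv_rev, CoxeterSystem.inv_simple, mul_assoc, mul_assoc,
      ← mul_assoc ((sys Γ).wordProd ω), ← mul_assoc ((sys Γ).wordProd ω * g),
      ← mul_assoc]

end RACG

open RACG LabeledGraph LabeledCubeComplex in
theorem mainTheorem11 {V : Type u} [Finite V] (Γ : SimpleGraph V) (G : Subgroup (RACG.W Γ))
    (Ω : RACG.LabeledCubeComplex.{u, w} Γ) (B : Ω.Vertex) (hΩ : Ω.IsCompletion B G) :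
    G.Normal ↔
      (∀ s : V, s ∉ RACG.commutingGenerators G →
        ∃ e : Ω.OEdge, Ω.skeleton.src e = B ∧ Ω.skeleton.label e = s) ∧
      (∀ v : Ω.Vertex, ∃ φ : RACG.LabeledGraph.Iso (Ω.core B) (Ω.core v),
        φ.vertex (Ω.coreBase B) = Ω.coreBase v) := by
  have hf := hΩ.folded
  have hc := hΩ.cubeFull
  have hB := hΩ.loopsRepresent
  refine ⟨fun hG => ⟨fun s hs => ?_, fun v => ?_⟩, fun ⟨h₁, h₂⟩ => ?_⟩
  · by_contra he
    refine hs (mem_commutingGenerators hG fun ω hω hm => he ?_)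
    obtain ⟨z, ⟨e, h₁, h₂, -⟩, -⟩ := reach_cons.1 (hB.2 _ hω hm)
    exact ⟨e, h₁, h₂⟩
  · obtain ⟨p, hp⟩ := hΩ.connected.2 B v
    exact exists_core_iso hf hc hB (hB.of_reach hf hc hG ⟨p, hp, rfl⟩)
  · refine normal_of_simple_conj_mem fun s g hg => ?_
    by_cases hs : s ∈ commutingGenerators G
    -- For `s` in Δ, conjugation by `s` fixes `g`, and no edge at the base vertex is needed.
    · rwa [hs g hg, CoxeterSystem.simple_mul_simple_cancel_right]
    obtain ⟨e, rfl, rfl⟩ := h₁ s hs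
    obtain ⟨φ, hφ⟩ := h₂ (Ω.skeleton.tgt e)
    obtain ⟨ω, hω, rfl⟩ := (sys Γ).exists_isReduced g
    -- A loop with reduced label lies in the core graph, so `φ` carries it to a loop with the same
    -- label at the other end of `e`.
    have hr := φ.reach (core_reach_of_isReduced hω (hB.2 ω hω hg))
    rw [hφ] at hr
    have he : Ω.skeleton.HasEdge _ _ _ := ⟨e, rfl, rfl, rfl⟩
    have := hB.1 _ (reach_cons.2
      ⟨_, he, reach_append.2 ⟨_, reach_of_core hr, reach_singleton.2 he.symm⟩⟩)
    rwa [CoxeterSystem.wordProd_cons, CoxeterSystem.wordProd_append,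
      CoxeterSystem.wordProd_singleton, ← mul_assoc] at this
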